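/- **Conventions.** Let $T$ be a topological semigroup with identity $e$ (not necessarily a group). A *semiflow* $(T,X)$ is a jointly continuous action $T\times X\to X$, $(t,x)\mapsto tx$, with $ex=x$ and $(st)x=s(tx)$, on a compact Hausdorff space $X$ (not necessarily metrizable). It is *minimal* if $Tx$ is dense in $X$ for every $x\in X$. It *admits an invariant measure* if there is a Borel probability measure $\mu$ on $X$ with $\mu(t^{-1}B)=\mu(B)$ for all Borel $B\subseteq X$ and $t\in T$, where $t^{-1}B=\{x: tx\in B\}$. It is *topologically transitive* if for all non-empty open $U,V\subseteq X$ there is $t\in T$ with $U\cap t^{-1}V\neq\emptyset$. If $(T,X)$ and $(T,Y)$ are semiflows, $T$ acts on $X\times Y$ by $t(x,y)=(tx,ty)$; $(T,X)$ is *weak-mixing* if $(T,X\times X)$ is topologically transitive. The *ergodic center* of $(T,Y)$ is the smallest closed subset $C\subseteq Y$ with $TC\subseteq C$ such that $\mu(C)=1$ for every invariant regular Borel probability measure $\mu$ on $Y$ (so it is $\emptyset$ if there is no such measure); it is *full* if it equals $Y$. The *regionally proximal relation* $Q(X)\subseteq X\times X$ consists of the pairs $(x,x')$ for which there are nets $(x_n)$,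 $(x_n')$ in $X$ and $(t_n)$ in $T$ with $x_n\to x$, $x_n'\to x'$ and $\lim_n t_nx_n=\lim_n t_nx_n'$ (both limits existing). **Theorem 1.7.** Let $(T,X)$ be a minimal semiflow which admits an invariant measure. Then the following are equivalent: 1. $(T,X)$ is weak-mixing; 2. $(T,X\times Y)$ is topologically transitive for every topologically transitive semiflow $(T,Y)$ with full ergodic center; 3. $Q(X)=X\times X$. -/

import Mathlib

open MeasureTheory Topology Filter

universe u v w

/-- The semiflow `(T, X)` admits an invariant measure: there is a Borel probability measure `μ` on
`X` with `μ (t⁻¹ B) = μ B` for every Borel set `B` and every `t : T`. -/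
def AdmitsInvariantMeasure (T : Type w) (X : Type u) [Monoid T] [MulAction T X]
    [MeasurableSpace X] : Prop :=
  ∃ μ : Measure X, IsProbabilityMeasure μ ∧ SMulInvariantMeasure T X μ

/-- `(T, X)` is weak-mixing: the diagonal action of `T` on `X × X` is topologically transitive. -/
def IsWeakMixing (T : Type w) (X : Type u) [Monoid T] [MulAction T X]
    [TopologicalSpace X] : Prop :=
  MulAction.IsTopologicallyTransitive T (X × X)

/-- The regionally proximal relation `Q(X)`: pairs `(x, x')` for which there are nets `xₙ → x`,
`x'ₙ → x'` in `X` and `tₙ` in `T` such that `tₙ xₙ` and `tₙ x'ₙ` converge to a common limit.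
(Index sets in the universe of `X` are enough, as a net can be re-indexed by neighbourhoods.) -/
def regionallyProximal (T : Type w) (X : Type u) [Monoid T] [MulAction T X]
    [TopologicalSpace X] : Set (X × X) :=
  {p | ∃ (ι : Type u) (_ : Preorder ι) (_ : IsDirectedOrder ι) (_ : Nonempty ι)
      (a b : ι → X) (t : ι → T) (z : X),
      Tendsto a atTop (𝓝 p.1) ∧ Tendsto b atTop (𝓝 p.2) ∧
      Tendsto (fun n => t n • a n) atTop (𝓝 z) ∧ Tendsto (fun n => t n • b n) atTop (𝓝 z)}

/-- `C` is a closed (forward) invariant subset of `X` that has measure `1` for every invariant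
regular Borel probability measure of `(T, X)`. -/
def IsErgodicCarrier (T : Type w) {X : Type u} [Monoid T] [MulAction T X]
    [TopologicalSpace X] [MeasurableSpace X] (C : Set X) : Prop :=
  IsClosed C ∧ (∀ t : T, ∀ x ∈ C, t • x ∈ C) ∧
    ∀ μ : Measure X, IsProbabilityMeasure μ → μ.Regular → SMulInvariantMeasure T X μ → μ C = 1

/-- The ergodic center of `(T, X)`: the smallest closed invariant subset of `X` that has measure
`1` for all invariant (regular Borel probability) measures; it is empty if there are none. -/
def ergodicCenter (T : Type w) (X : Type u) [Monoid T] [MulAction T X]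
    [TopologicalSpace X] [MeasurableSpace X] : Set X :=
  ⋂₀ {C | IsErgodicCarrier T C}

/-- The ergodic center is indeed the smallest set of the kind described. -/
theorem isLeast_ergodicCenter (T : Type w) (X : Type u) [Monoid T] [MulAction T X]
    [TopologicalSpace X] [MeasurableSpace X] [BorelSpace X] :
    IsLeast {C : Set X | IsErgodicCarrier T C} (ergodicCenter T X) := by
  refine ⟨⟨isClosed_sInter fun C hC => hC.1,
    fun t x hx C hC => hC.2.1 t x (hx C hC), fun μ hp hr hi => ?_⟩, fun C hC => Set.sInter_subset_of_mem hC⟩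
  have hcl : IsClosed (ergodicCenter T X) := isClosed_sInter fun C hC => hC.1
  refine (prob_compl_eq_zero_iff hcl.measurableSet).1 ?_
  rw [hcl.isOpen_compl.measure_eq_iSup_isCompact]
  simp only [ENNReal.iSup_eq_zero]
  intro K hK hKc
  refine hKc.measure_zero_of_nhdsWithin fun x hx => ?_
  obtain ⟨C, hC, hxC⟩ : ∃ C, IsErgodicCarrier T C ∧ x ∉ C := by
    by_contra! h
    exact hK hx fun C hC => h C hC
  exact ⟨Cᶜ, mem_nhdsWithin_of_mem_nhds (hC.1.isOpen_compl.mem_nhds hxC),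
    (prob_compl_eq_zero_iff hC.1.measurableSet).2 (hC.2.2 μ hp hr hi)⟩

/-- `(T, X)` has full ergodic center. -/
def HasFullErgodicCenter (T : Type w) (X : Type u) [Monoid T] [MulAction T X]
    [TopologicalSpace X] [MeasurableSpace X] : Prop :=
  ergodicCenter T X = Set.univ

/-! Weak mixing brings a pair near (x, x') close to (x, x), so every pair is regionally proximal;
and the product condition with Y = X is weak mixing, since invariant measures live on all of a
minimal X. The core is 3 → 2. Let W be the orbit closure of an open box U × V, with sections W_x ⊆
Y, and let ν be invariant on Y. Since W_x ⊆ t⁻¹W_{tx}, minimality and upper semicontinuity make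
ν(W_x) constant. Hence d(x, x') = ν(W_x \ W_{x'}) is a continuous pseudometric that does not
decrease under T, so it vanishes on regionally proximal pairs. If all pairs are such, V \ W_x is
open and null for every ν, hence empty: X × V ⊆ W. Transitivity of Y and surjectivity of T on X then
let W meet every open box. -/

open Set

section

variable {T : Type w} [Monoid T]

/-! ### Full ergodic centers and invariant measures -/

/-- In a semiflow with full ergodic center, every open set which is null for all invariant measures
is empty. -/
theorem HasFullErgodicCenter.eq_empty_of_measure_eq_zero {Y : Type u} [TopologicalSpace Y]
    [MeasurableSpace Y] [BorelSpace Y] [MulAction T Y] [ContinuousConstSMul T Y]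
    (hY : HasFullErgodicCenter T Y) {G : Set Y} (hG : IsOpen G)
    (h : ∀ ν : Measure Y, IsProbabilityMeasure ν → ν.Regular → SMulInvariantMeasure T Y ν →
      ν G = 0) : G = ∅ := by
  have hopen : IsOpen (⋃ t : T, (t • ·) ⁻¹' G) :=
    isOpen_iUnion fun t => hG.preimage (continuous_const_smul t)
  have hC : IsErgodicCarrier T (⋃ t : T, (t • ·) ⁻¹' G : Set Y)ᶜ := by
    refine ⟨hopen.isClosed_compl, fun t x hx hx' => hx ?_, fun ν hp hr hi => ?_⟩
    · obtain ⟨s, hs⟩ := mem_iUnion.1 hx'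
      exact mem_iUnion.2 ⟨s * t, by simpa [mul_smul] using hs⟩
    -- `T` may be uncountable; by inner regularity it is enough to treat compact subsets, where
    -- nullity is a local question.
    · rw [prob_compl_eq_one_iff hopen.measurableSet, hopen.measure_eq_iSup_isCompact]
      simp only [ENNReal.iSup_eq_zero]
      intro K hK hKc
      refine hKc.measure_zero_of_nhdsWithin fun x hx => ?_
      obtain ⟨t, ht⟩ := mem_iUnion.1 (hK hx)
      refine ⟨(t • ·) ⁻¹' G, mem_nhdsWithin_of_mem_nhds
        ((hG.preimage (continuous_const_smul t)).mem_nhds ht), ?_⟩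
      rw [measure_preimage_smul_of_nullMeasurableSet hG.measurableSet.nullMeasurableSet]
      exact h ν hp hr hi
  refine eq_empty_of_forall_notMem fun x hx => ?_
  have hxC : x ∈ ergodicCenter T Y := by rw [hY]; trivial
  exact hxC _ hC (mem_iUnion.2 ⟨1, by simpa using hx⟩)

/-- An invariant measure of a semiflow may be chosen regular. -/
theorem AdmitsInvariantMeasure.exists_regular {X : Type u} [TopologicalSpace X] [CompactSpace X]
    [T2Space X] [MeasurableSpace X] [BorelSpace X] [MulAction T X] [ContinuousConstSMul T X]
    (h : AdmitsInvariantMeasure T X) :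
    ∃ ν : Measure X, IsProbabilityMeasure ν ∧ ν.Regular ∧ SMulInvariantMeasure T X ν := by
  obtain ⟨μ, hμ, hinv⟩ := h
  obtain ⟨ν, hr, hf, hν⟩ := Measure.exists_regular_eq_of_compactSpace μ
  refine ⟨ν, ⟨?_⟩, hr, ⟨fun t s hs => ?_⟩⟩
  · have := hν 1
    simp only [BoundedContinuousFunction.coe_one, Pi.one_apply, integral_const, probReal_univ,
      smul_eq_mul, mul_one] at this
    rw [← ENNReal.toReal_eq_one_iff]
    exact this.symm
  · have hm : Measurable (fun x : X => t • x) := (continuous_const_smul t).measurable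
    -- Regularity of both measures reduces invariance to integrals of continuous functions, on which
    -- `ν` agrees with `μ`.
    have : (ν.map (t • ·)).InnerRegular :=
      Measure.InnerRegular.map_of_continuous (continuous_const_smul t)
    have heq : ν.map (t • ·) = ν := by
      refine Measure.ext_of_integral_eq_on_compactlySupported fun f => ?_
      rw [integral_map hm.aemeasurable (by fun_prop)]
      have h1 := hν (BoundedContinuousFunction.mkOfCompact f.toContinuousMap)
      have h2 := hν (BoundedContinuousFunction.mkOfCompact
        (f.toContinuousMap.comp ⟨(t • ·), continuous_const_smul t⟩))
      have hmap : μ.map (t • ·) = μ := by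
        ext s hs
        rw [Measure.map_apply hm hs]
        exact hinv.measure_preimage_smul t hs
      calc ∫ x, f (t • x) ∂ν = ∫ x, f (t • x) ∂μ := h2.symm
        _ = ∫ x, f x ∂(μ.map (t • ·)) := (integral_map hm.aemeasurable (by fun_prop)).symm
        _ = ∫ x, f x ∂μ := by rw [hmap]
        _ = ∫ x, f x ∂ν := h1
    rw [← Measure.map_apply hm hs, heq]

/-- A minimal semiflow with an invariant measure has full ergodic center. -/
theorem AdmitsInvariantMeasure.hasFullErgodicCenter {X : Type u} [TopologicalSpace X]
    [CompactSpace X] [T2Space X] [MeasurableSpace X] [BorelSpace X] [MulAction T X]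
    [ContinuousConstSMul T X] [MulAction.IsMinimal T X] (h : AdmitsInvariantMeasure T X) :
    HasFullErgodicCenter T X := by
  obtain ⟨ν, hp, hr, hi⟩ := h.exists_regular
  obtain ⟨hcl, hsm, hmeas⟩ := (isLeast_ergodicCenter T X).1
  refine (eq_empty_or_univ_of_smul_invariant_closed T hcl fun t => ?_).resolve_left fun h0 => ?_
  · rintro _ ⟨x, hx, rfl⟩
    exact hsm t x hx
  · have := hmeas ν hp hr hi
    simp [h0] at this

/-- If the ergodic center is full, then every element of the monoid acts surjectively. -/
theorem HasFullErgodicCenter.smul_surjective {X : Type u} [TopologicalSpace X]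
    [CompactSpace X] [T2Space X] [MeasurableSpace X] [BorelSpace X] [MulAction T X]
    [ContinuousConstSMul T X] (h : HasFullErgodicCenter T X) (t : T) :
    Function.Surjective (t • · : X → X) := by
  have hcl : IsClosed (range (t • · : X → X)) := (isCompact_range (continuous_const_smul t)).isClosed
  refine range_eq_univ.1 (compl_empty_iff.1 (h.eq_empty_of_measure_eq_zero hcl.isOpen_compl ?_))
  intro ν _ _ hi
  rw [← hi.measure_preimage_smul t hcl.isOpen_compl.measurableSet]
  simp

/-! ### Weak mixing and regional proximality -/

/-- A weak-mixing semiflow has `Q(X) = X × X`. -/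
theorem IsWeakMixing.regionallyProximal_eq_univ {X : Type u} [TopologicalSpace X] [MulAction T X]
    (h : IsWeakMixing T X) : regionallyProximal T X = univ := by
  refine eq_univ_of_forall fun p => ?_
  -- Closed sets missing a point encode its open neighbourhoods, so increasing inclusion shrinks the
  -- neighbourhood.
  let ι := {C : Set X // p.1 ∉ C ∧ IsClosed C} × {C : Set X // p.2 ∉ C ∧ IsClosed C}
  have key : ∀ i : ι, ∃ (a b : X) (t : T), a ∉ i.1.1 ∧ b ∉ i.2.1 ∧ t • a ∉ i.1.1 ∧
      t • b ∉ i.1.1 := by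
    intro i
    have h1 := i.1.2.2.isOpen_compl
    have h2 := i.2.2.2.isOpen_compl
    obtain ⟨t, _, ⟨⟨a, b⟩, hab, rfl⟩, hW⟩ := h.exists_smul_inter
      (h1.prod h2) ⟨(p.1, p.2), i.1.2.1, i.2.2.1⟩
      (h1.prod h1) ⟨(p.1, p.1), i.1.2.1, i.1.2.1⟩
    exact ⟨a, b, t, hab.1, hab.2, hW.1, hW.2⟩
  choose a b t ha hb hta htb using key
  have hdir : IsDirectedOrder ι := ⟨fun i j =>
    ⟨(⟨i.1.1 ∪ j.1.1, fun h => h.elim i.1.2.1 j.1.2.1, i.1.2.2.union j.1.2.2⟩,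
      ⟨i.2.1 ∪ j.2.1, fun h => h.elim i.2.2.1 j.2.2.1, i.2.2.2.union j.2.2.2⟩),
      ⟨subset_union_left, subset_union_left⟩, ⟨subset_union_right, subset_union_right⟩⟩⟩
  let bot : ι := (⟨∅, id, isClosed_empty⟩, ⟨∅, id, isClosed_empty⟩)
  have lim1 : ∀ c : ι → X, (∀ i, c i ∉ i.1.1) → Tendsto c atTop (𝓝 p.1) := by
    intro c hc
    refine (nhds_basis_opens p.1).tendsto_right_iff.2 fun U hU => ?_
    filter_upwards [eventually_ge_atTop
      ((⟨Uᶜ, not_not.2 hU.1, hU.2.isClosed_compl⟩, bot.2) : ι)] with i hi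
    exact not_not.1 fun hn => hc i (hi.1 hn)
  have lim2 : ∀ c : ι → X, (∀ i, c i ∉ i.2.1) → Tendsto c atTop (𝓝 p.2) := by
    intro c hc
    refine (nhds_basis_opens p.2).tendsto_right_iff.2 fun U hU => ?_
    filter_upwards [eventually_ge_atTop
      ((bot.1, ⟨Uᶜ, not_not.2 hU.1, hU.2.isClosed_compl⟩) : ι)] with i hi
    exact not_not.1 fun hn => hc i (hi.2 hn)
  exact ⟨ι, inferInstance, hdir, ⟨bot⟩, a, b, t, p.1, lim1 a ha, lim2 b hb, lim1 _ hta, lim1 _ htb⟩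

/-! ### Sections of closed invariant sets -/

/-- The sections of a closed set depend upper semicontinuously on the base point. -/
theorem IsClosed.eventually_section_subset {X : Type*} {Y : Type*} [TopologicalSpace X]
    [TopologicalSpace Y] [CompactSpace Y] {W : Set (X × Y)} (hW : IsClosed W) {x : X} {O : Set Y}
    (hO : IsOpen O) (hx : Prod.mk x ⁻¹' W ⊆ O) : ∀ᶠ x' in 𝓝 x, Prod.mk x' ⁻¹' W ⊆ O := by
  have hcl : IsClosed (Prod.fst '' (W ∩ Prod.snd ⁻¹' Oᶜ)) :=
    isClosedMap_fst_of_compactSpace _ (hW.inter (hO.isClosed_compl.preimage continuous_snd))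
  have hx' : x ∉ Prod.fst '' (W ∩ Prod.snd ⁻¹' Oᶜ) := by
    rintro ⟨⟨_, y⟩, ⟨hy, hyO⟩, rfl⟩
    exact hyO (hx hy)
  filter_upwards [hcl.isOpen_compl.mem_nhds hx'] with x' h y hy
  by_contra hyO
  exact h ⟨(x', y), ⟨hy, hyO⟩, rfl⟩

theorem IsClosed.measurableSet_section {X Y : Type*} [TopologicalSpace X] [TopologicalSpace Y]
    [MeasurableSpace Y] [BorelSpace Y] {W : Set (X × Y)} (hW : IsClosed W) (x : X) :
    MeasurableSet (Prod.mk x ⁻¹' W) :=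
  (hW.preimage (Continuous.prodMk_right x)).measurableSet

theorem measure_section_le_smul {X Y : Type*} [TopologicalSpace X] [TopologicalSpace Y]
    [MeasurableSpace Y] [BorelSpace Y] [MulAction T X] [MulAction T Y] {W : Set (X × Y)}
    {ν : Measure Y} [SMulInvariantMeasure T Y ν] (hW : IsClosed W)
    (hinv : ∀ t : T, ∀ p ∈ W, t • p ∈ W) (t : T) (x : X) :
    ν (Prod.mk x ⁻¹' W) ≤ ν (Prod.mk (t • x) ⁻¹' W) := by
  rw [← measure_preimage_smul_of_nullMeasurableSet (μ := ν)
    (hW.measurableSet_section (t • x)).nullMeasurableSet t]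
  exact measure_mono fun y hy => hinv t (x, y) hy

theorem measure_sdiff_triangle {Y : Type*} [MeasurableSpace Y] (ν : Measure Y) (A B C : Set Y) :
    ν (A \ C) ≤ ν (A \ B) + ν (B \ C) :=
  (measure_mono fun _ hw => or_iff_not_imp_left.2 fun h =>
    ⟨not_not.1 fun hy => h ⟨hw.1, hy⟩, hw.2⟩).trans (measure_union_le _ _)

section Sections

variable {X : Type u} {Y : Type v} [TopologicalSpace X] [TopologicalSpace Y] [CompactSpace Y]
  [MeasurableSpace Y] [BorelSpace Y] [MulAction T X] [MulAction T Y]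
  {W : Set (X × Y)} {ν : Measure Y} [ν.Regular]
  [SMulInvariantMeasure T Y ν]

/-- The sections of a closed invariant set over a minimal semiflow all have the same measure. -/
theorem measure_section_eq [MulAction.IsMinimal T X] (hW : IsClosed W)
    (hinv : ∀ t : T, ∀ p ∈ W, t • p ∈ W) (x x' : X) :
    ν (Prod.mk x ⁻¹' W) = ν (Prod.mk x' ⁻¹' W) := by
  have key : ∀ x x' : X, ν (Prod.mk x ⁻¹' W) ≤ ν (Prod.mk x' ⁻¹' W) := by
    intro x x'
    by_contra! hlt
    -- The orbit of `x` comes near `x'`, where sections lie in `O`; yet measures only grow along the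
    -- orbit.
    obtain ⟨O, hsub, hO, hOlt⟩ := Set.exists_isOpen_lt_of_lt _ _ hlt
    obtain ⟨_, ⟨t, rfl⟩, ht⟩ := mem_closure_iff_nhds.1 (denseRange_smul T x x') _
      (hW.eventually_section_subset hO hsub) |>.imp fun _ h => h.symm
    exact absurd ((measure_section_le_smul hW hinv t x).trans (measure_mono ht)) hOlt.not_ge
  exact (key x x').antisymm (key x' x)

variable [IsProbabilityMeasure ν]

/-- Both sections have the same finite measure. This turns one-sided semicontinuity into continuity.
-/
theorem measure_section_sdiff_comm [MulAction.IsMinimal T X] (hW : IsClosed W)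
    (hinv : ∀ t : T, ∀ p ∈ W, t • p ∈ W) (x x' : X) :
    ν (Prod.mk x ⁻¹' W \ Prod.mk x' ⁻¹' W) = ν (Prod.mk x' ⁻¹' W \ Prod.mk x ⁻¹' W) := by
  rw [← Set.sdiff_inter_self_eq_sdiff, inter_comm,
    ← Set.sdiff_inter_self_eq_sdiff (t := Prod.mk x ⁻¹' W),
    measure_sdiff inter_subset_left
      ((hW.measurableSet_section x).inter (hW.measurableSet_section x')).nullMeasurableSet
      (measure_ne_top _ _),
    measure_sdiff inter_subset_right
      ((hW.measurableSet_section x).inter (hW.measurableSet_section x')).nullMeasurableSet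
      (measure_ne_top _ _), measure_section_eq (T := T) hW hinv x x']

theorem eventually_measure_section_sdiff_le (hW : IsClosed W) (x : X) {ε : ENNReal} (hε : ε ≠ 0) :
    ∀ᶠ x' in 𝓝 x, ν (Prod.mk x' ⁻¹' W \ Prod.mk x ⁻¹' W) ≤ ε := by
  obtain ⟨O, hsub, hO, -, hlt⟩ := (hW.measurableSet_section x).exists_isOpen_sdiff_lt
    (measure_ne_top ν _) hε
  filter_upwards [hW.eventually_section_subset hO hsub] with x' hx'
  exact (measure_mono (sdiff_subset_sdiff_left hx')).trans hlt.le

/-- A section and the `t`-preimage of its translate are nested with equal measure, so they differ by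
a null set. -/
theorem measure_section_sdiff_le_smul [MulAction.IsMinimal T X] (hW : IsClosed W)
    (hinv : ∀ t : T, ∀ p ∈ W, t • p ∈ W) (t : T) (x x' : X) :
    ν (Prod.mk x ⁻¹' W \ Prod.mk x' ⁻¹' W) ≤
      ν (Prod.mk (t • x) ⁻¹' W \ Prod.mk (t • x') ⁻¹' W) := by
  have hpre : ∀ s : Set Y, MeasurableSet s → ν ((t • ·) ⁻¹' s) = ν s := fun s hs =>
    measure_preimage_smul_of_nullMeasurableSet hs.nullMeasurableSet t
  have hnull : ν ((t • ·) ⁻¹' (Prod.mk (t • x') ⁻¹' W) \ Prod.mk x' ⁻¹' W) = 0 := by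
    have hsub : Prod.mk x' ⁻¹' W ⊆ (t • ·) ⁻¹' (Prod.mk (t • x') ⁻¹' W) :=
      fun y hy => hinv t (x', y) hy
    rw [measure_sdiff hsub
      (hW.measurableSet_section x').nullMeasurableSet (measure_ne_top _ _),
      hpre _ (hW.measurableSet_section _), measure_section_eq (T := T) hW hinv (t • x') x',
      tsub_self]
  calc ν (Prod.mk x ⁻¹' W \ Prod.mk x' ⁻¹' W)
      ≤ ν ((t • ·) ⁻¹' (Prod.mk (t • x) ⁻¹' W \ Prod.mk (t • x') ⁻¹' W) ∪
          ((t • ·) ⁻¹' (Prod.mk (t • x') ⁻¹' W) \ Prod.mk x' ⁻¹' W)) := by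
        refine measure_mono fun y hy => ?_
        by_cases hy' : (t • x', t • y) ∈ W
        · exact Or.inr ⟨hy', hy.2⟩
        · exact Or.inl ⟨hinv t (x, y) hy.1, hy'⟩
    _ ≤ _ := (measure_union_le _ _).trans_eq <| by
        rw [hnull, add_zero,
          hpre _ ((hW.measurableSet_section _).diff (hW.measurableSet_section _))]

/-- The sections of a closed invariant set over regionally proximal points agree almost
everywhere. -/
theorem measure_section_sdiff_eq_zero [MulAction.IsMinimal T X] (hW : IsClosed W)
    (hinv : ∀ t : T, ∀ p ∈ W, t • p ∈ W) {x x' : X} (hQ : (x, x') ∈ regionallyProximal T X) :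
    ν (Prod.mk x ⁻¹' W \ Prod.mk x' ⁻¹' W) = 0 := by
  obtain ⟨ι, _, _, _, a, b, t, z, ha, hb, hta, htb⟩ := hQ
  refine le_antisymm (ENNReal.le_of_forall_pos_le_add fun ε hε _ => ?_) zero_le
  have hε4 : (ε / 4 : ENNReal) ≠ 0 := by simp [hε.ne']
  obtain ⟨n, h1, h2, h3, h4⟩ := ((ha.eventually (eventually_measure_section_sdiff_le
    (ν := ν) hW x hε4)).and
    ((hb.eventually (eventually_measure_section_sdiff_le (ν := ν) hW x' hε4)).and
    ((hta.eventually (eventually_measure_section_sdiff_le (ν := ν) hW z hε4)).and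
    (htb.eventually (eventually_measure_section_sdiff_le (ν := ν) hW z hε4))))).exists
  -- Semicontinuity bounds only nearby section minus limit section; two of the four legs of x → aₙ →
  -- bₙ → x', with the middle leg passing through `z` after applying `tₙ`, need the opposite order.
  rw [measure_section_sdiff_comm (T := T) hW hinv] at h1 h4
  have h5 := (measure_section_sdiff_le_smul (ν := ν) hW hinv (t n) (a n) (b n)).trans
    ((measure_sdiff_triangle _ _ (Prod.mk z ⁻¹' W) _).trans (add_le_add h3 h4))
  calc _ ≤ ν (Prod.mk x ⁻¹' W \ Prod.mk (a n) ⁻¹' W) +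
        (ν (Prod.mk (a n) ⁻¹' W \ Prod.mk (b n) ⁻¹' W) +
          ν (Prod.mk (b n) ⁻¹' W \ Prod.mk x' ⁻¹' W)) :=
        (measure_sdiff_triangle _ _ _ _).trans
          (add_le_add le_rfl (measure_sdiff_triangle _ _ _ _))
    _ ≤ (ε / 4 : ENNReal) + (ε / 4 + ε / 4 + ε / 4) := add_le_add h1 (add_le_add h5 h2)
    _ = 0 + ε := by
      rw [zero_add, ← ENNReal.coe_ofNat, ← ENNReal.coe_div (by simp)]
      norm_cast
      ring

end Sections

/-! ### Transitivity of products -/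

/-- A minimal semiflow with an invariant measure and `Q(X) = X × X` has a topologically transitive
product with every topologically transitive semiflow with full ergodic center. -/
theorem isTopologicallyTransitive_prod_of_regionallyProximal_eq_univ {X : Type u} {Y : Type v}
    [TopologicalSpace X] [CompactSpace X] [T2Space X] [MeasurableSpace X] [BorelSpace X]
    [MulAction T X] [ContinuousConstSMul T X] [MulAction.IsMinimal T X]
    (hX : AdmitsInvariantMeasure T X) (hQ : regionallyProximal T X = univ)
    [TopologicalSpace Y] [CompactSpace Y] [MeasurableSpace Y] [BorelSpace Y]
    [MulAction T Y] [ContinuousConstSMul T Y] (hY : MulAction.IsTopologicallyTransitive T Y)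
    (hfull : HasFullErgodicCenter T Y) : MulAction.IsTopologicallyTransitive T (X × Y) := by
  refine ⟨fun {A B} hA ⟨⟨x₀, y₀⟩, hxy⟩ hB ⟨⟨x₁, y₁⟩, hxy'⟩ => ?_⟩
  obtain ⟨U, V, hU, hV, hxU, hyV, hUV⟩ := isOpen_prod_iff.1 hA x₀ y₀ hxy
  obtain ⟨U', V', hU', hV', hxU', hyV', hUV'⟩ := isOpen_prod_iff.1 hB x₁ y₁ hxy'
  let W : Set (X × Y) := closure (⋃ t : T, (t • ·) '' (U ×ˢ V))
  have hWc : IsClosed W := isClosed_closure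
  have hWinv : ∀ t : T, ∀ p ∈ W, t • p ∈ W := by
    intro t
    refine MapsTo.closure (fun p hp => ?_) (continuous_const_smul t)
    obtain ⟨s, q, hq, rfl⟩ := mem_iUnion.1 hp
    exact mem_iUnion.2 ⟨t * s, q, hq, mul_smul t s q⟩
  have hVW : ∀ x, V ⊆ Prod.mk x ⁻¹' W := by
    intro x
    rw [← sdiff_eq_empty]
    refine hfull.eq_empty_of_measure_eq_zero
      (hV.sdiff (hWc.preimage (Continuous.prodMk_right x))) fun ν _ _ _ => ?_
    refine measure_mono_null (sdiff_subset_sdiff_left fun y hy => ?_)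
      (measure_section_sdiff_eq_zero hWc hWinv (x := x₀) (x' := x) (by rw [hQ]; trivial))
    exact subset_closure (mem_iUnion.2 ⟨1, (x₀, y), ⟨hxU, hy⟩, one_smul T _⟩)
  obtain ⟨t, _, ⟨y, hy, rfl⟩, hty⟩ := hY.exists_smul_inter hV ⟨y₀, hyV⟩ hV' ⟨y₁, hyV'⟩
  -- As `t` need not be invertible, surjectivity supplies the point of X × V that lands over `x₁`.
  obtain ⟨x, hx⟩ := hX.hasFullErgodicCenter.smul_surjective t x₁
  have hmem : (x₁, t • y) ∈ W := hx ▸ hWinv t (x, y) (hVW x hy)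
  obtain ⟨q, hq, hqm⟩ := mem_closure_iff.1 hmem _ (hU'.prod hV') ⟨hxU', hty⟩
  obtain ⟨s, hs⟩ := mem_iUnion.1 hqm
  exact ⟨s, q, image_mono hUV hs, hUV' hq⟩

/-- Topological transitivity of products with all topologically transitive semiflows with full
ergodic center forces a minimal semiflow with an invariant measure to be weak-mixing. -/
theorem isWeakMixing_of_forall_prod [TopologicalSpace T] {X : Type u}
    [TopologicalSpace X] [CompactSpace X] [T2Space X] [MeasurableSpace X] [BorelSpace X]
    [MulAction T X] [ContinuousSMul T X] [MulAction.IsMinimal T X]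
    (hX : AdmitsInvariantMeasure T X)
    (h : ∀ (Y : Type (max u v)) [TopologicalSpace Y] [CompactSpace Y] [T2Space Y]
        [MeasurableSpace Y] [BorelSpace Y] [MulAction T Y] [ContinuousSMul T Y],
        MulAction.IsTopologicallyTransitive T Y → HasFullErgodicCenter T Y →
          MulAction.IsTopologicallyTransitive T (X × Y)) : IsWeakMixing T X := by
  -- This is X itself, lifted only to match the universe of the quantified `Y`.
  let Y := ULift.{v} X
  let _ : MeasurableSpace Y := borel Y
  have : BorelSpace Y := ⟨rfl⟩
  have : ContinuousSMul T Y := ⟨continuous_uliftUp.comp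
    (continuous_fst.smul (continuous_uliftDown.comp continuous_snd))⟩
  have : MulAction.IsMinimal T Y := ⟨fun y =>
    ULift.up_surjective.denseRange.comp (denseRange_smul T y.down) continuous_uliftUp⟩
  have hm : Measurable (ULift.up : X → Y) := continuous_uliftUp.measurable
  have hYinv : AdmitsInvariantMeasure T Y := by
    obtain ⟨μ, hp, hi⟩ := hX
    refine ⟨μ.map ULift.up, Measure.isProbabilityMeasure_map hm.aemeasurable,
      ⟨fun t s hs => ?_⟩⟩
    rw [Measure.map_apply hm hs,
      Measure.map_apply hm ((continuous_const_smul t).measurable hs)]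
    exact hi.measure_preimage_smul t (hm hs)
  have hXY := h Y inferInstance hYinv.hasFullErgodicCenter
  refine ⟨fun {A B} hA hAne hB hBne => ?_⟩
  have hf : Continuous (fun p : X × ULift.{v} X => (p.1, p.2.down)) := by fun_prop
  have hs : Function.Surjective (fun p : X × ULift.{v} X => (p.1, p.2.down)) :=
    fun p => ⟨(p.1, ⟨p.2⟩), rfl⟩
  obtain ⟨t, _, ⟨p, hp, rfl⟩, hpB⟩ := hXY.exists_smul_inter (hA.preimage hf)
    (hAne.preimage hs) (hB.preimage hf) (hBne.preimage hs)
  exact ⟨t, _, ⟨_, hp, rfl⟩, hpB⟩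

end

theorem theorem1p7 (T : Type w) [Monoid T] [TopologicalSpace T] [ContinuousMul T]
    (X : Type u) [TopologicalSpace X] [CompactSpace X] [T2Space X]
    [MeasurableSpace X] [BorelSpace X] [MulAction T X] [ContinuousSMul T X]
    (hmin : MulAction.IsMinimal T X) (hinv : AdmitsInvariantMeasure T X) :
    List.TFAE [
      IsWeakMixing T X,
      ∀ (Y : Type (max u v)) [TopologicalSpace Y] [CompactSpace Y] [T2Space Y]
        [MeasurableSpace Y] [BorelSpace Y] [MulAction T Y] [ContinuousSMul T Y],
        MulAction.IsTopologicallyTransitive T Y → HasFullErgodicCenter T Y →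
          MulAction.IsTopologicallyTransitive T (X × Y),
      regionallyProximal T X = Set.univ] := by
  tfae_have 1 → 3 := fun h => h.regionallyProximal_eq_univ
  tfae_have 3 → 2 := fun h Y _ _ _ _ _ _ _ hY hfull =>
    isTopologicallyTransitive_prod_of_regionallyProximal_eq_univ hinv h hY hfull
  tfae_have 2 → 1 := fun h => isWeakMixing_of_forall_prod.{u, v, w} hinv h
  tfae_finish
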